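/- Let $L>0$ and let $V$ be a real-valued integrable potential on $(0,L)$ that is bounded below (in particular, any continuous $V$ on $[0,L]$). Let $\lambda_0$ be the lowest eigenvalue of $H=-\frac{d^2}{dx^2}+V(x)$ on $(0,L)$ with periodic boundary conditions $u(0)=u(L)$, $u'(0)=u'(L)$, and define \[ V_m=\inf_{0<x<L}V(x),\qquad I=\frac1L\int_0^L\bigl[V(x)-V_m\bigr]^{1/2}\,dx . \] Then \[ \lambda_0\ \ge\ \begin{cases} V_m+I^2, & \text{if } I\le \pi/L,\\[2pt] V_m+\dfrac{\pi^2}{L^2}, & \text{if } I>\pi/L,\end{cases} \] and when $I<\pi/L$, equality $\lambda_0=V_m+I^2$ holds if and only if $V$ is constant (almost everywhere on $(0,L)$; hence everywhere if $V$ is continuous). Both bounds are sharp: for all real $m$ and $J\ge 0$, the infimum of $\lambda_0$ over all continuous $L$-periodic potentials $V$ with $V_m=m$ and $I=J$ equals $m+J^2$ if $J\le\pi/L$, and equals $m+\pi^2/L^2$ if $J>\pi/L$. -/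

import Mathlib

open MeasureTheory Set

noncomputable section

/-- `u` is an eigenfunction, with eigenvalue `E`, of `H = -d²/dx² + V` on `(0, L)` with periodic
boundary conditions: `u` is not identically zero on `[0, L]`, it is differentiable there with an
absolutely continuous derivative `w`, the equation `-u'' + V u = E u` holds almost everywhere on
`(0, L)`, and `u(0) = u(L)`, `u'(0) = u'(L)`. If `V` is continuous on `[0, L]`, such a `u` is a
classical (twice continuously differentiable) solution. -/
def IsPeriodicEigenfunction (L : ℝ) (V : ℝ → ℝ) (E : ℝ) (u : ℝ → ℝ) : Prop :=
  (∃ x ∈ Icc 0 L, u x ≠ 0) ∧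
  ∃ w : ℝ → ℝ,
    (∀ x ∈ Icc 0 L, HasDerivWithinAt u (w x) (Icc 0 L) x) ∧
    AbsolutelyContinuousOnInterval w 0 L ∧
    (∀ᵐ x ∂volume.restrict (Ioo 0 L), -deriv w x + V x * u x = E * u x) ∧
    u 0 = u L ∧ w 0 = w L

/-- The set of eigenvalues of `-d²/dx² + V` on `(0, L)` with periodic boundary conditions. -/
def periodicEigenvalues (L : ℝ) (V : ℝ → ℝ) : Set ℝ :=
  {E | ∃ u : ℝ → ℝ, IsPeriodicEigenfunction L V E u}

/-- `E` is the principal (lowest) eigenvalue `λ₀` of `-d²/dx² + V` on `(0, L)` with periodic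
boundary conditions. -/
def IsPrincipalEigenvalue (L : ℝ) (V : ℝ → ℝ) (E : ℝ) : Prop :=
  IsLeast (periodicEigenvalues L V) E

/-- `V_m = inf_{0 < x < L} V(x)`. -/
def potentialInf (L : ℝ) (V : ℝ → ℝ) : ℝ :=
  sInf (V '' Ioo 0 L)

/-- `I = (1/L) ∫₀ᴸ (V(x) - V_m)^{1/2} dx`. -/
def meanSqrt (L : ℝ) (V : ℝ → ℝ) : ℝ :=
  (1 / L) * ∫ x in (0 : ℝ)..L, Real.sqrt (V x - potentialInf L V)

/-- The principal eigenvalues of all continuous `L`-periodic potentials `V` (that is, continuous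
potentials on the circle of length `L`) with `inf V = m` and `I = J`. -/
def principalEigenvaluesWith (L m J : ℝ) : Set ℝ :=
  {E | ∃ V : ℝ → ℝ, Continuous V ∧ Function.Periodic V L ∧
    potentialInf L V = m ∧ meanSqrt L V = J ∧ IsPrincipalEigenvalue L V E}

end

/-! ### Absolutely continuous functions -/

/-! Lower bound: put `τ = t √(V - V_m)` with `0 ≤ t ≤ 1` and `k = t I`. Since `τ² ≤ V - V_m`, the
energy of `u` above `V_m` dominates `∫ (w² + τ² u²) = ∫ |v'|²`, where `v = u e^{i∫τ}` and `v(L) =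
e^{ikL} v(0)`. The difference `y = v - u(0) e^{ikx}` vanishes at both ends. As `e^{ikx}` solves
`-f'' = k² f`, the cross terms cancel and `∫ (|v'|² - k² |v|²) = ∫ (|y'|² - k² |y|²)`, which is at
least `(κ² - k²) ∫ |y|²` for `κ < π/L` (`twisted_poincare`). Taking `κ = k` gives the bounds; if `I
< κ < π/L`, equality forces `y = 0`, so `|u|`, and then `V`, is constant.

Sharpness: a positive periodic function `e^h` is the ground state of `E + h'' + h'²`. With `h = α
log f`, `f = 1 + s (1 - cos (2πx/L))`, negative `α` gives a nearly constant potential with a narrow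
dip, approaching the first bound; `α` slightly above `1/2` gives arbitrarily large `I` at an energy
close to the second. -/

theorem AbsolutelyContinuousOnInterval.lipschitz_comp {f φ : ℝ → ℝ} {a b : ℝ}
    (hφ : LipschitzWith 1 φ) (hf : AbsolutelyContinuousOnInterval f a b) :
    AbsolutelyContinuousOnInterval (fun x => φ (f x)) a b := by
  refine squeeze_zero (fun t => Finset.sum_nonneg fun i _ => dist_nonneg) (fun t => ?_) hf
  refine Finset.sum_le_sum fun i _ => ?_
  simpa using hφ.dist_le_mul (f (t.2 i).1) (f (t.2 i).2)

theorem absolutelyContinuousOnInterval_of_hasDerivWithinAt {u w : ℝ → ℝ} {a b : ℝ} (hab : a ≤ b)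
    (hu : ∀ x ∈ Icc a b, HasDerivWithinAt u (w x) (Icc a b) x) (hw : ContinuousOn w (Icc a b)) :
    AbsolutelyContinuousOnInterval u a b := by
  obtain ⟨C, hC⟩ := isCompact_Icc.exists_bound_of_continuousOn hw
  have h := (convex_Icc a b).lipschitzOnWith_of_nnnorm_hasDerivWithin_le (C := C.toNNReal) hu
    (fun x hx => by
      rw [← NNReal.coe_le_coe, coe_nnnorm]
      exact (hC x hx).trans (Real.le_coe_toNNReal C))
  rw [← uIcc_of_le hab] at h
  exact h.absolutelyContinuousOnInterval

/-- The fundamental theorem of calculus as an inequality: if `F' ≤ R` almost everywhere, then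
`F b - F a ≤ ∫ R`. -/
theorem AbsolutelyContinuousOnInterval.sub_le_integral {F R : ℝ → ℝ} {a b : ℝ} (hab : a ≤ b)
    (hF : AbsolutelyContinuousOnInterval F a b) (hR : IntervalIntegrable R volume a b)
    (h : ∀ᵐ x, x ∈ Ioo a b → ∃ d, HasDerivAt F d x ∧ d ≤ R x) :
    F b - F a ≤ ∫ x in a..b, R x := by
  rw [← hF.integral_deriv_eq_sub]
  refine intervalIntegral.integral_mono_ae_restrict hab hF.intervalIntegrable_deriv hR ?_
  rw [← restrict_Ioo_eq_restrict_Icc]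
  refine (ae_restrict_iff' measurableSet_Ioo).2 ?_
  filter_upwards [h] with x hx hxm
  obtain ⟨d, hd, hdR⟩ := hx hxm
  rw [hd.deriv]
  exact hdR

/-- A continuous nonnegative function on `[a, b]` with nonpositive integral vanishes. -/
theorem eqOn_zero_of_integral_nonpos {f : ℝ → ℝ} {a b : ℝ} (hab : a < b)
    (hf : ContinuousOn f (Icc a b)) (h0 : ∀ x ∈ Icc a b, 0 ≤ f x)
    (hi : ∫ x in a..b, f x ≤ 0) : ∀ x ∈ Icc a b, f x = 0 := by
  by_contra! hne
  obtain ⟨c, hc, hfc⟩ := hne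
  have := intervalIntegral.integral_pos hab hf (fun x hx => h0 x (Ioc_subset_Icc_self hx))
    ⟨c, hc, lt_of_le_of_ne (h0 c hc) (Ne.symm hfc)⟩
  linarith

/-! ### The Poincaré inequality with a quasi-periodic phase -/

/-- The algebraic identity behind the inequality: `C = cos ψ`, `S = sin ψ`. -/
theorem twisted_energy_identity (u w τ k κ g u₀ C S : ℝ) (h : S ^ 2 + C ^ 2 = 1) :
    (-κ ^ 2 - g ^ 2) * (u ^ 2 - 2 * u₀ * (u * C) + u₀ ^ 2)
      + g * (2 * u * w - 2 * u₀ * (w * C + u * (-S * (τ - k))))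
      + 2 * k * u₀ * (w * S + u * (C * (τ - k)))
    = w ^ 2 + τ ^ 2 * u ^ 2 - (k ^ 2 * u ^ 2
        + (κ ^ 2 - k ^ 2) * (u ^ 2 - 2 * u₀ * (u * C) + u₀ ^ 2))
      - ((w * C - τ * u * S - g * (u * C - u₀)) ^ 2
        + (w * S + τ * u * C - k * u₀ - g * (u * S)) ^ 2) := by
  linear_combination (w ^ 2 + τ ^ 2 * u ^ 2 + g ^ 2 * u ^ 2 - 2 * g * w * u) * h

/-- The Dirichlet inequality for `y = u e^{i∫τ} - u(0) e^{ikx}`, written in real form: the bracket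
multiplying `κ² - k²` is `|y|²`. The difference of the two integrands is the derivative of a
function with equal end values plus the square `|y' - g y|²`. -/
theorem twisted_poincare {L : ℝ} (hL : 0 < L) {u w τ : ℝ → ℝ} {k κ : ℝ}
    (hu : ∀ x ∈ Icc 0 L, HasDerivWithinAt u (w x) (Icc 0 L) x) (hw : ContinuousOn w (Icc 0 L))
    (hper : u 0 = u L) (hτ : IntervalIntegrable τ volume 0 L)
    (hτu : IntervalIntegrable (fun x => τ x ^ 2 * u x ^ 2) volume 0 L)
    (hk : ∫ x in (0 : ℝ)..L, τ x = k * L) (hκ0 : 0 ≤ κ) (hκ : κ < Real.pi / L) :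
    ∫ x in (0 : ℝ)..L, (k ^ 2 * u x ^ 2 + (κ ^ 2 - k ^ 2) * (u x ^ 2
        - 2 * u 0 * (u x * Real.cos ((∫ y in (0 : ℝ)..x, τ y) - k * x)) + u 0 ^ 2))
      ≤ ∫ x in (0 : ℝ)..L, (w x ^ 2 + τ x ^ 2 * u x ^ 2) := by
  set ψ : ℝ → ℝ := fun x => (∫ y in (0 : ℝ)..x, τ y) - k * x with hψ
  -- The logarithmic derivative of `cos (κ (x - L/2))`, which has no zero on `[0, L]` because `κ <
  -- π/L`. It solves the Riccati equation `g' = -κ² - g²`.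
  set g : ℝ → ℝ := fun x => -κ * Real.tan (κ * (x - L / 2)) with hg
  have hcos : ∀ x ∈ Icc 0 L, Real.cos (κ * (x - L / 2)) ≠ 0 := fun x hx => by
    have h1 : κ * L < Real.pi := by rwa [lt_div_iff₀ hL] at hκ
    have h2 : κ * (x - L / 2) ≤ κ * (L / 2) := by
      apply mul_le_mul_of_nonneg_left _ hκ0; linarith [hx.2]
    have h3 : κ * (-(L / 2)) ≤ κ * (x - L / 2) := by
      apply mul_le_mul_of_nonneg_left _ hκ0; linarith [hx.1]
    exact (Real.cos_pos_of_mem_Ioo ⟨by nlinarith, by nlinarith⟩).ne'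
  have hgd : ∀ x ∈ Icc 0 L, HasDerivAt g (-κ ^ 2 - g x ^ 2) x := fun x hx => by
    have h1 : HasDerivAt (fun x : ℝ => κ * (x - L / 2)) κ x := by
      simpa using ((hasDerivAt_id x).sub_const (L / 2)).const_mul κ
    have h2 := ((Real.hasDerivAt_tan (hcos x hx)).comp x h1).const_mul (-κ)
    convert! h2 using 1
    simp only [hg, Real.tan_eq_sin_div_cos]
    have hc := hcos x hx
    have hsc := Real.sin_sq_add_cos_sq (κ * (x - L / 2))
    generalize Real.cos (κ * (x - L / 2)) = C at hc hsc ⊢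
    generalize Real.sin (κ * (x - L / 2)) = S at hsc ⊢
    field_simp
    linear_combination (-κ ^ 2) * hsc
  have hgc : ContinuousOn g (Icc 0 L) := fun x hx => (hgd x hx).continuousAt.continuousWithinAt
  have hguc : uIcc 0 L = Icc 0 L := uIcc_of_le hL.le
  have hgac : AbsolutelyContinuousOnInterval g 0 L :=
    absolutelyContinuousOnInterval_of_hasDerivWithinAt hL.le
      (fun x hx => (hgd x hx).hasDerivWithinAt) (by fun_prop)
  have huac := absolutelyContinuousOnInterval_of_hasDerivWithinAt hL.le hu hw
  have huc : ContinuousOn u (Icc 0 L) := fun x hx => (hu x hx).continuousWithinAt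
  have hidac : AbsolutelyContinuousOnInterval (fun x : ℝ => x) 0 L :=
    absolutelyContinuousOnInterval_of_hasDerivWithinAt hL.le
      (fun x _ => hasDerivWithinAt_id x _) continuousOn_const
  have hcst : ∀ c : ℝ, AbsolutelyContinuousOnInterval (fun _ : ℝ => c) 0 L := fun c =>
    absolutelyContinuousOnInterval_of_hasDerivWithinAt hL.le
      (fun x _ => hasDerivWithinAt_const x _ c) continuousOn_const
  have hψac : AbsolutelyContinuousOnInterval ψ 0 L :=
    (hτ.absolutelyContinuousOnInterval_intervalIntegral left_mem_uIcc).fun_sub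
      (hidac.const_mul k)
  have hψc : ContinuousOn ψ (Icc 0 L) := hguc ▸ hψac.continuousOn
  have hψ0 : ψ 0 = 0 := by simp [hψ]
  have hψL : ψ L = 0 := by simp [hψ, hk]
  have hcac := hψac.lipschitz_comp Real.lipschitzWith_cos
  have hsac := hψac.lipschitz_comp Real.lipschitzWith_sin
  -- `g |y|²` plus the cross term against `u(0) e^{ikx}`; both vanish at the ends, where `ψ = 0`.
  set F : ℝ → ℝ := fun x => g x * (u x ^ 2 - 2 * u 0 * (u x * Real.cos (ψ x)) + u 0 ^ 2)
    + 2 * k * u 0 * (u x * Real.sin (ψ x)) with hF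
  have hFac : AbsolutelyContinuousOnInterval F 0 L := by
    simp only [hF, sq]
    exact (hgac.fun_mul (((huac.fun_mul huac).fun_sub
      ((huac.fun_mul hcac).const_mul _)).fun_add (hcst _))).fun_add
      ((huac.fun_mul hsac).const_mul _)
  have hF0 : F L - F 0 = 0 := by
    simp only [hF, hψ0, hψL, ← hper, Real.cos_zero, Real.sin_zero]; ring
  have hLHS : IntervalIntegrable (fun x => k ^ 2 * u x ^ 2 + (κ ^ 2 - k ^ 2) * (u x ^ 2
        - 2 * u 0 * (u x * Real.cos (ψ x)) + u 0 ^ 2)) volume 0 L := by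
    apply ContinuousOn.intervalIntegrable
    rw [hguc]
    fun_prop
  have hRHS : IntervalIntegrable (fun x => w x ^ 2 + τ x ^ 2 * u x ^ 2) volume 0 L := by
    refine IntervalIntegrable.add (ContinuousOn.intervalIntegrable ?_) hτu
    rw [hguc]
    fun_prop
  rw [← sub_nonneg, ← intervalIntegral.integral_sub hRHS hLHS]
  refine hF0.ge.trans (hFac.sub_le_integral hL.le (hRHS.sub hLHS) ?_)
  filter_upwards [hτ.ae_hasDerivAt_integral] with x hx hxm
  have hxI : x ∈ Icc 0 L := Ioo_subset_Icc_self hxm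
  have hud : HasDerivAt u (w x) x := (hu x hxI).hasDerivAt (Icc_mem_nhds hxm.1 hxm.2)
  have hψd : HasDerivAt ψ (τ x - k) x := by
    simpa using! (hx (hguc ▸ hxI) 0 left_mem_uIcc).sub ((hasDerivAt_id x).const_mul k)
  have hd := ((hgd x hxI).mul (((hud.pow 2).sub ((hud.mul hψd.cos).const_mul (2 * u 0))).add_const
    (u 0 ^ 2))).add ((hud.mul hψd.sin).const_mul (2 * k * u 0))
  refine ⟨_, hd, ?_⟩
  have key := twisted_energy_identity (u x) (w x) (τ x) k κ (g x) (u 0) (Real.cos (ψ x))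
    (Real.sin (ψ x)) (Real.sin_sq_add_cos_sq _)
  have hsq := add_nonneg
    (sq_nonneg (w x * Real.cos (ψ x) - τ x * u x * Real.sin (ψ x)
      - g x * (u x * Real.cos (ψ x) - u 0)))
    (sq_nonneg (w x * Real.sin (ψ x) + τ x * u x * Real.cos (ψ x) - k * u 0
      - g x * (u x * Real.sin (ψ x))))
  simp only [Pi.sub_apply, Pi.mul_apply, Pi.pow_apply] at *
  norm_num
  linarith

/-! ### The lower bound -/

theorem energy_identity {L E : ℝ} (hL : 0 < L) {V u w : ℝ → ℝ}
    (hu : ∀ x ∈ Icc 0 L, HasDerivWithinAt u (w x) (Icc 0 L) x)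
    (hw : AbsolutelyContinuousOnInterval w 0 L)
    (hode : ∀ᵐ x ∂volume.restrict (Ioo 0 L), -deriv w x + V x * u x = E * u x)
    (hu0 : u 0 = u L) (hw0 : w 0 = w L) :
    ∫ x in (0 : ℝ)..L, (w x ^ 2 + (V x - E) * u x ^ 2) = 0 := by
  have hwc : ContinuousOn w (Icc 0 L) := uIcc_of_le hL.le ▸ hw.continuousOn
  have huac := absolutelyContinuousOnInterval_of_hasDerivWithinAt hL.le hu hwc
  have h := hw.integral_deriv_mul_eq_sub huac
  rw [← hu0, ← hw0, sub_self] at h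
  refine Eq.trans (intervalIntegral.integral_congr_ae_restrict ?_) h
  rw [uIoc_of_le hL.le, ← restrict_Ioo_eq_restrict_Ioc]
  filter_upwards [hode, ae_restrict_mem measurableSet_Ioo] with x hx hxm
  have hud : HasDerivAt u (w x) x :=
    (hu x (Ioo_subset_Icc_self hxm)).hasDerivAt (Icc_mem_nhds hxm.1 hxm.2)
  rw [hud.deriv]
  linear_combination (u x) * hx

theorem integral_sq_pos {L : ℝ} (hL : 0 < L) {u : ℝ → ℝ} (hu : ContinuousOn u (Icc 0 L))
    (hne : ∃ x ∈ Icc 0 L, u x ≠ 0) : 0 < ∫ x in (0 : ℝ)..L, u x ^ 2 := by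
  obtain ⟨c, hc, huc⟩ := hne
  exact intervalIntegral.integral_pos hL (by fun_prop) (fun x _ => sq_nonneg _)
    ⟨c, hc, by positivity⟩

theorem potentialInf_le {L : ℝ} {V : ℝ → ℝ} (hb : BddBelow (V '' Ioo 0 L)) {x : ℝ}
    (hx : x ∈ Ioo 0 L) : potentialInf L V ≤ V x :=
  csInf_le hb (mem_image_of_mem V hx)

theorem intervalIntegrable_sqrt {f : ℝ → ℝ} {a b : ℝ} (hf : IntervalIntegrable f volume a b) :
    IntervalIntegrable (fun x => Real.sqrt (f x)) volume a b := by
  refine IntervalIntegrable.mono_fun (g := fun x => Real.sqrt (f x))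
    ((intervalIntegrable_const (c := (1 : ℝ))).add hf.norm) ?_ ?_
  · exact Real.continuous_sqrt.comp_aestronglyMeasurable hf.def'.aestronglyMeasurable
  · refine Filter.Eventually.of_forall fun x => ?_
    have h0 : 0 ≤ 1 + |f x| := by positivity
    simp only [Real.norm_eq_abs, abs_of_nonneg (Real.sqrt_nonneg _)]
    rw [abs_of_nonneg h0]
    refine Real.sqrt_le_iff.2 ⟨h0, ?_⟩
    nlinarith [le_abs_self (f x), abs_nonneg (f x)]

/-- The energy inequality for a periodic eigenfunction, for the phase `∫ t √(V - V_m)`. -/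
theorem eigenfunction_energy_bound {L E t κ : ℝ} (hL : 0 < L) {V u w : ℝ → ℝ}
    (hV : IntervalIntegrable V volume 0 L) (hb : BddBelow (V '' Ioo 0 L))
    (hu : ∀ x ∈ Icc 0 L, HasDerivWithinAt u (w x) (Icc 0 L) x)
    (hw : AbsolutelyContinuousOnInterval w 0 L)
    (hode : ∀ᵐ x ∂volume.restrict (Ioo 0 L), -deriv w x + V x * u x = E * u x)
    (hu0 : u 0 = u L) (hw0 : w 0 = w L)
    (ht0 : 0 ≤ t) (ht1 : t ≤ 1) (hκ0 : 0 ≤ κ) (hκ : κ < Real.pi / L) :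
    ∃ ψ : ℝ → ℝ, ContinuousOn ψ (Icc 0 L) ∧
      (t * meanSqrt L V) ^ 2 * (∫ x in (0 : ℝ)..L, u x ^ 2)
        + (κ ^ 2 - (t * meanSqrt L V) ^ 2) * (∫ x in (0 : ℝ)..L, (u x ^ 2
          - 2 * u 0 * (u x * Real.cos (ψ x)) + u 0 ^ 2))
      ≤ (E - potentialInf L V) * ∫ x in (0 : ℝ)..L, u x ^ 2 := by
  have huIcc : uIcc 0 L = Icc 0 L := uIcc_of_le hL.le
  have hwc : ContinuousOn w (Icc 0 L) := huIcc ▸ hw.continuousOn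
  have huc : ContinuousOn u (Icc 0 L) := fun x hx => (hu x hx).continuousWithinAt
  set c := potentialInf L V with hc
  have hVc : IntervalIntegrable (fun x => V x - c) volume 0 L := hV.sub intervalIntegrable_const
  have hτ : IntervalIntegrable (fun x => t * Real.sqrt (V x - c)) volume 0 L :=
    (intervalIntegrable_sqrt hVc).const_mul t
  have hu2 : ContinuousOn (fun x => u x ^ 2) (uIcc 0 L) := by rw [huIcc]; fun_prop
  have hVu : ∀ d : ℝ, IntervalIntegrable (fun x => (V x - d) * u x ^ 2) volume 0 L := fun d =>
    (hV.sub intervalIntegrable_const).mul_continuousOn hu2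
  have hsq : ∀ x ∈ Ioo 0 L, (t * Real.sqrt (V x - c)) ^ 2 * u x ^ 2
      = t ^ 2 * ((V x - c) * u x ^ 2) := fun x hx => by
    rw [mul_pow, Real.sq_sqrt (sub_nonneg.2 (potentialInf_le hb hx))]; ring
  have hτu : IntervalIntegrable (fun x => (t * Real.sqrt (V x - c)) ^ 2 * u x ^ 2) volume 0 L := by
    refine ((hVu c).const_mul (t ^ 2)).congr_ae ?_
    rw [uIoc_of_le hL.le, ← restrict_Ioo_eq_restrict_Ioc]
    filter_upwards [ae_restrict_mem measurableSet_Ioo] with x hx using (hsq x hx).symm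
  have hk : ∫ x in (0 : ℝ)..L, t * Real.sqrt (V x - c) = (t * meanSqrt L V) * L := by
    rw [intervalIntegral.integral_const_mul, meanSqrt, ← hc]
    field_simp
  have hP := twisted_poincare hL hu hwc hu0 hτ hτu hk hκ0 hκ
  set ψ : ℝ → ℝ := fun x => (∫ y in (0 : ℝ)..x, t * Real.sqrt (V y - c)) - t * meanSqrt L V * x
    with hψ
  have hψc : ContinuousOn ψ (Icc 0 L) := by
    have := (hτ.absolutelyContinuousOnInterval_intervalIntegral left_mem_uIcc).continuousOn
    rw [huIcc] at this
    exact this.sub (by fun_prop)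
  have hw2 : IntervalIntegrable (fun x => w x ^ 2) volume 0 L :=
    ContinuousOn.intervalIntegrable (by rw [huIcc]; fun_prop)
  refine ⟨ψ, hψc, ?_⟩
  calc _ = ∫ x in (0 : ℝ)..L, ((t * meanSqrt L V) ^ 2 * u x ^ 2 +
          (κ ^ 2 - (t * meanSqrt L V) ^ 2) * (u x ^ 2
          - 2 * u 0 * (u x * Real.cos (ψ x)) + u 0 ^ 2)) := by
        symm
        rw [intervalIntegral.integral_add, intervalIntegral.integral_const_mul,
          intervalIntegral.integral_const_mul]
        · exact ContinuousOn.intervalIntegrable (by rw [huIcc]; fun_prop)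
        · exact ContinuousOn.intervalIntegrable (by rw [huIcc]; fun_prop)
    _ ≤ ∫ x in (0 : ℝ)..L, (w x ^ 2 + (t * Real.sqrt (V x - c)) ^ 2 * u x ^ 2) := hP
    _ ≤ ∫ x in (0 : ℝ)..L, ((w x ^ 2 + (V x - E) * u x ^ 2) + (E - c) * u x ^ 2) := by
        refine intervalIntegral.integral_mono_on_of_le_Ioo hL.le (hw2.add hτu)
          ((hw2.add (hVu E)).add (hu2.intervalIntegrable.const_mul _)) fun x hx => ?_
        rw [hsq x hx]
        have h1 : 0 ≤ (V x - c) * u x ^ 2 :=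
          mul_nonneg (sub_nonneg.2 (potentialInf_le hb hx)) (sq_nonneg _)
        have h2 : t ^ 2 ≤ 1 := pow_le_one₀ ht0 ht1
        nlinarith
    _ = _ := by
        rw [intervalIntegral.integral_add (hw2.add (hVu E))
          (hu2.intervalIntegrable.const_mul _), energy_identity hL hu hw hode hu0 hw0,
          intervalIntegral.integral_const_mul, zero_add]

theorem meanSqrt_nonneg {L : ℝ} (hL : 0 < L) (V : ℝ → ℝ) : 0 ≤ meanSqrt L V :=
  mul_nonneg (by positivity)
    (intervalIntegral.integral_nonneg hL.le fun x _ => Real.sqrt_nonneg _)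

theorem le_distance_sq (a b θ : ℝ) : (|a| - |b|) ^ 2 ≤ a ^ 2 - 2 * b * (a * Real.cos θ) + b ^ 2 := by
  have h1 : b * (a * Real.cos θ) ≤ |a| * |b| := by
    calc b * (a * Real.cos θ) ≤ |b * (a * Real.cos θ)| := le_abs_self _
      _ = |a| * |b| * |Real.cos θ| := by rw [abs_mul, abs_mul]; ring
      _ ≤ |a| * |b| * 1 := by gcongr; exact Real.abs_cos_le_one θ
      _ = |a| * |b| := mul_one _
  nlinarith [sq_abs a, sq_abs b]

theorem eigenvalue_lower_bound {L E k : ℝ} (hL : 0 < L) {V : ℝ → ℝ}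
    (hV : IntervalIntegrable V volume 0 L) (hb : BddBelow (V '' Ioo 0 L))
    (hE : E ∈ periodicEigenvalues L V)
    (hk0 : 0 ≤ k) (hkI : k ≤ meanSqrt L V) (hk : k < Real.pi / L) :
    potentialInf L V + k ^ 2 ≤ E := by
  obtain ⟨u, hne, w, hu, hw, hode, hu0, hw0⟩ := hE
  have huc : ContinuousOn u (Icc 0 L) := fun x hx => (hu x hx).continuousWithinAt
  have hpos := integral_sq_pos hL huc hne
  -- Shrinking the phase lowers its mean slope to `k < π/L` even when `I` is larger; with `κ = k`
  -- the extra term drops out.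
  obtain ⟨t, ht0, ht1, rfl⟩ : ∃ t : ℝ, 0 ≤ t ∧ t ≤ 1 ∧ t * meanSqrt L V = k := by
    rcases (meanSqrt_nonneg hL V).eq_or_lt with h | h
    · exact ⟨0, le_rfl, zero_le_one, by linarith⟩
    · exact ⟨k / meanSqrt L V, by positivity, (div_le_one h).2 hkI, by field_simp⟩
  obtain ⟨ψ, -, h⟩ := eigenfunction_energy_bound hL hV hb hu hw hode hu0 hw0 ht0 ht1 hk0 hk
  rw [sub_self, zero_mul, add_zero] at h
  linarith [le_of_mul_le_mul_right h hpos]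

/-- Passage to the limit `k → b`. The separate bound `c ≤ E` covers `b = 0`, where no `k` is
available. -/
theorem add_sq_le_of_forall_lt {c b E : ℝ} (hb : 0 ≤ b)
    (h : ∀ k, 0 ≤ k → k < b → c + k ^ 2 ≤ E) (hE : c ≤ E) : c + b ^ 2 ≤ E := by
  have h1 : b ≤ Real.sqrt (E - c) := by
    refine le_of_forall_lt fun k hk => ?_
    rcases lt_or_ge k 0 with hk0 | hk0
    · exact hk0.trans_le (Real.sqrt_nonneg _)
    · obtain ⟨k', hk', hk'b⟩ := exists_between hk
      refine hk'.trans_le (Real.le_sqrt_of_sq_le ?_)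
      linarith [h k' (hk0.trans hk'.le) hk'b]
  have h2 := Real.sq_sqrt (sub_nonneg.2 hE)
  nlinarith [Real.sqrt_nonneg (E - c)]

theorem eigenvalue_lower_bound_small {L E : ℝ} (hL : 0 < L) {V : ℝ → ℝ}
    (hV : IntervalIntegrable V volume 0 L) (hb : BddBelow (V '' Ioo 0 L))
    (hE : E ∈ periodicEigenvalues L V) (hI : meanSqrt L V ≤ Real.pi / L) :
    potentialInf L V + meanSqrt L V ^ 2 ≤ E := by
  refine add_sq_le_of_forall_lt (meanSqrt_nonneg hL V) (fun k hk0 hk =>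
    eigenvalue_lower_bound hL hV hb hE hk0 hk.le (hk.trans_le hI)) ?_
  simpa using eigenvalue_lower_bound hL hV hb hE le_rfl (meanSqrt_nonneg hL V) (by positivity)

theorem eigenvalue_lower_bound_large {L E : ℝ} (hL : 0 < L) {V : ℝ → ℝ}
    (hV : IntervalIntegrable V volume 0 L) (hb : BddBelow (V '' Ioo 0 L))
    (hE : E ∈ periodicEigenvalues L V) (hI : Real.pi / L < meanSqrt L V) :
    potentialInf L V + Real.pi ^ 2 / L ^ 2 ≤ E := by
  rw [← div_pow]
  refine add_sq_le_of_forall_lt (by positivity) (fun k hk0 hk =>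
    eigenvalue_lower_bound hL hV hb hE hk0 (hk.trans hI).le hk) ?_
  simpa using eigenvalue_lower_bound hL hV hb hE le_rfl (meanSqrt_nonneg hL V) (by positivity)

/-- Equality in the lower bound forces the eigenfunction, hence the potential, to be constant. -/
theorem potential_const_of_eigenvalue_eq {L E : ℝ} (hL : 0 < L) {V : ℝ → ℝ}
    (hV : IntervalIntegrable V volume 0 L) (hb : BddBelow (V '' Ioo 0 L))
    (hE : E ∈ periodicEigenvalues L V) (hI : meanSqrt L V < Real.pi / L)
    (heq : E = potentialInf L V + meanSqrt L V ^ 2) :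
    ∀ᵐ x ∂volume.restrict (Ioo 0 L), V x = E := by
  obtain ⟨u, hne, w, hu, hw, hode, hu0, hw0⟩ := hE
  have huc : ContinuousOn u (Icc 0 L) := fun x hx => (hu x hx).continuousWithinAt
  -- A `κ` strictly above `I` keeps a positive coefficient on `∫ |y|²`, which equality then forces
  -- to vanish.
  obtain ⟨κ, hκI, hκ⟩ := exists_between hI
  have hI0 := meanSqrt_nonneg hL V
  obtain ⟨ψ, hψc, h⟩ := eigenfunction_energy_bound hL hV hb hu hw hode hu0 hw0 zero_le_one le_rfl
    (hI0.trans hκI.le) hκ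
  rw [one_mul, heq, add_sub_cancel_left] at h
  have hgap : 0 < κ ^ 2 - meanSqrt L V ^ 2 := by nlinarith
  have hN : ∫ x in (0 : ℝ)..L, (u x ^ 2 - 2 * u 0 * (u x * Real.cos (ψ x)) + u 0 ^ 2) ≤ 0 := by
    by_contra! hcon
    nlinarith [mul_pos hgap hcon]
  have hzero := eqOn_zero_of_integral_nonpos hL (by fun_prop)
    (fun x _ => (sq_nonneg _).trans (le_distance_sq (u x) (u 0) (ψ x))) hN
  have habs : ∀ x ∈ Icc 0 L, |u x| = |u 0| := fun x hx => by
    have := (le_distance_sq (u x) (u 0) (ψ x)).trans (hzero x hx).le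
    linarith [pow_eq_zero_iff (two_ne_zero) |>.1 (le_antisymm this (sq_nonneg _))]
  have hu0ne : ∀ x ∈ Icc 0 L, u x ≠ 0 := fun x hx => by
    obtain ⟨y, hy, huy⟩ := hne
    rw [← abs_pos] at huy ⊢
    rwa [habs x hx, ← habs y hy]
  have hwz : ∀ x ∈ Ioo 0 L, w x = 0 := fun x hx => by
    have hud : HasDerivAt u (w x) x :=
      (hu x (Ioo_subset_Icc_self hx)).hasDerivAt (Icc_mem_nhds hx.1 hx.2)
    -- Only `|u|` is known to be constant, so `u²` is differentiated: `2 u w = 0` with `u ≠ 0`.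
    have h1 := hud.pow 2
    have h2 : HasDerivAt (fun _ : ℝ => u 0 ^ 2) 0 x := hasDerivAt_const _ _
    have h3 : (u ^ 2) =ᶠ[nhds x] fun _ => u 0 ^ 2 := by
      filter_upwards [Ioo_mem_nhds hx.1 hx.2] with y hy
      simpa using (sq_eq_sq_iff_abs_eq_abs _ _).2 (habs y (Ioo_subset_Icc_self hy))
    have h4 := h1.unique (h2.congr_of_eventuallyEq h3)
    simpa [hu0ne x (Ioo_subset_Icc_self hx)] using h4
  filter_upwards [hode, ae_restrict_mem measurableSet_Ioo] with x hx hxm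
  have hdw : deriv w x = 0 := by
    have h3 : w =ᶠ[nhds x] fun _ => 0 := by
      filter_upwards [Ioo_mem_nhds hxm.1 hxm.2] with y hy using hwz y hy
    rw [h3.deriv_eq, deriv_const]
  rw [hdw, neg_zero, zero_add] at hx
  exact mul_right_cancel₀ (hu0ne x (Ioo_subset_Icc_self hxm)) hx

theorem principalEigenvalue_eq_of_potential_const {L E c : ℝ} (hL : 0 < L) {V : ℝ → ℝ}
    (hV : IntervalIntegrable V volume 0 L) (hb : BddBelow (V '' Ioo 0 L))
    (hE : IsPrincipalEigenvalue L V E) (hI : meanSqrt L V < Real.pi / L)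
    (hc : ∀ᵐ x ∂volume.restrict (Ioo 0 L), V x = c) :
    E = potentialInf L V + meanSqrt L V ^ 2 := by
  have hle : potentialInf L V ≤ c := by
    have hne : (ae (volume.restrict (Ioo 0 L))).NeBot := by
      rw [ae_neBot, Ne, Measure.restrict_eq_zero, Real.volume_Ioo]
      simpa using hL
    obtain ⟨x, hx, hxm⟩ := (hc.and (ae_restrict_mem measurableSet_Ioo)).exists
    exact hx ▸ potentialInf_le hb hxm
  have hIc : meanSqrt L V = Real.sqrt (c - potentialInf L V) := by
    have : ∫ x in (0 : ℝ)..L, Real.sqrt (V x - potentialInf L V)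
        = ∫ x in (0 : ℝ)..L, Real.sqrt (c - potentialInf L V) := by
      refine intervalIntegral.integral_congr_ae_restrict ?_
      rw [uIoc_of_le hL.le, ← restrict_Ioo_eq_restrict_Ioc]
      filter_upwards [hc] with x hx
      rw [hx]
    rw [meanSqrt, this, intervalIntegral.integral_const]
    simp only [sub_zero, smul_eq_mul]
    field_simp
  have hsq : meanSqrt L V ^ 2 = c - potentialInf L V := by
    rw [hIc, Real.sq_sqrt (sub_nonneg.2 hle)]
  refine le_antisymm ?_ (eigenvalue_lower_bound_small hL hV hb hE.1 hI.le)
  rw [hsq, add_sub_cancel]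
  refine hE.2 ⟨fun _ => 1, ⟨0, by simp [hL.le], one_ne_zero⟩, fun _ => 0,
    fun x _ => hasDerivWithinAt_const _ _ _, ?_, ?_, rfl, rfl⟩
  · exact absolutelyContinuousOnInterval_of_hasDerivWithinAt hL.le
      (fun x _ => hasDerivWithinAt_const x _ (0 : ℝ)) continuousOn_const
  · filter_upwards [hc] with x hx
    simp [hx]

/-! ### Potentials with a prescribed ground state -/

/-- If `h` is periodic and twice continuously differentiable, then `exp h` is a positive periodic
eigenfunction for the potential `E + h'' + h'²`, so that `E` is its lowest eigenvalue. -/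
theorem isPrincipalEigenvalue_of_log_groundState {L : ℝ} (hL : 0 < L) {h g q : ℝ → ℝ}
    (hh : ∀ x, HasDerivAt h (g x) x) (hg : ∀ x, HasDerivAt g (q x) x) (hq : Continuous q)
    (hh0 : h 0 = h L) (hg0 : g 0 = g L) (E : ℝ) :
    IsPrincipalEigenvalue L (fun x => E + (q x + g x ^ 2)) E := by
  have hhc : Continuous h := continuous_iff_continuousAt.2 fun x => (hh x).continuousAt
  have hgc : Continuous g := continuous_iff_continuousAt.2 fun x => (hg x).continuousAt
  have hu : ∀ x, HasDerivAt (fun x => Real.exp (h x)) (g x * Real.exp (h x)) x := fun x => by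
    simpa [mul_comm] using (hh x).exp
  have hw : ∀ x, HasDerivAt (fun x => g x * Real.exp (h x))
      ((q x + g x ^ 2) * Real.exp (h x)) x := fun x => by
    convert! (hg x).mul (hu x) using 1
    ring
  refine ⟨⟨fun x => Real.exp (h x), ⟨0, by simp [hL.le], (Real.exp_pos _).ne'⟩,
    fun x => g x * Real.exp (h x), fun x _ => (hu x).hasDerivWithinAt, ?_, ?_, ?_, ?_⟩, ?_⟩
  · exact absolutelyContinuousOnInterval_of_hasDerivWithinAt hL.le
      (fun x _ => (hw x).hasDerivWithinAt) (by fun_prop)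
  · refine Filter.Eventually.of_forall fun x => ?_
    rw [(hw x).deriv]
    ring
  · simp only [hh0]
  · simp only [hh0, hg0]
  · rintro E' ⟨u, hne, w, hu, hw, hode, hu0, hw0⟩
    have huIcc : uIcc 0 L = Icc 0 L := uIcc_of_le hL.le
    have hwc : ContinuousOn w (Icc 0 L) := huIcc ▸ hw.continuousOn
    have huc : ContinuousOn u (Icc 0 L) := fun x hx => (hu x hx).continuousWithinAt
    have hpos := integral_sq_pos hL huc hne
    have hen := energy_identity hL hu hw hode hu0 hw0
    have huac := absolutelyContinuousOnInterval_of_hasDerivWithinAt hL.le hu hwc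
    have hgac : AbsolutelyContinuousOnInterval g 0 L :=
      absolutelyContinuousOnInterval_of_hasDerivWithinAt hL.le
        (fun x _ => (hg x).hasDerivWithinAt) hq.continuousOn
    have hint : IntervalIntegrable (fun x => w x ^ 2 + (q x + g x ^ 2) * u x ^ 2) volume 0 L :=
      ContinuousOn.intervalIntegrable (by rw [huIcc]; fun_prop)
    have hint2 : IntervalIntegrable (fun x => (E' - E) * u x ^ 2) volume 0 L :=
      ContinuousOn.intervalIntegrable (by rw [huIcc]; fun_prop)
    -- Minimality by Jacobi's trick: `(w - g u)² ≥ 0` says `(g u²)' ≤ w² + (q + g²) u²`, and `g u²`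
    -- has equal end values.
    have hF := (hgac.fun_mul (huac.fun_mul huac)).sub_le_integral hL.le hint
      (Filter.Eventually.of_forall fun x hx => by
        have hud : HasDerivAt u (w x) x :=
          (hu x (Ioo_subset_Icc_self hx)).hasDerivAt (Icc_mem_nhds hx.1 hx.2)
        refine ⟨_, (hg x).mul (hud.mul hud), ?_⟩
        nlinarith [sq_nonneg (w x - g x * u x)])
    rw [← hu0, ← hg0, sub_self] at hF
    have hsplit : ∫ x in (0 : ℝ)..L, (w x ^ 2 + (q x + g x ^ 2) * u x ^ 2)
        = (E' - E) * ∫ x in (0 : ℝ)..L, u x ^ 2 := by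
      rw [← intervalIntegral.integral_const_mul, ← sub_eq_zero,
        ← intervalIntegral.integral_sub hint hint2, ← hen]
      congr 1
      ext x
      ring
    rw [hsplit] at hF
    linarith [nonneg_of_mul_nonneg_left hF hpos]

/-- The minimum may sit at an endpoint, outside the open interval; continuity covers that case. -/
theorem potentialInf_eq_of_isMin {L m x₀ : ℝ} (hL : 0 < L) {V : ℝ → ℝ} (hV : Continuous V)
    (hm : ∀ x, m ≤ V x) (hx₀ : x₀ ∈ Icc 0 L) (hVx₀ : V x₀ = m) : potentialInf L V = m := by
  have hb : BddBelow (V '' Ioo 0 L) := ⟨m, by rintro _ ⟨x, -, rfl⟩; exact hm x⟩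
  refine le_antisymm ?_ (le_csInf ((nonempty_Ioo.2 hL).image V) ?_)
  · rw [← hVx₀]
    rw [← closure_Ioo hL.ne] at hx₀
    exact closure_minimal (s := Ioo 0 L) (t := {x | potentialInf L V ≤ V x})
      (fun x hx => potentialInf_le hb hx) (isClosed_le continuous_const hV) hx₀
  · rintro _ ⟨x, -, rfl⟩
    exact hm x

/-- The potential `h'' + h'²` for `h = α log (1 + s (1 - cos (ω x)))`. -/
noncomputable def dipPotential (ω α s x : ℝ) : ℝ :=
  α * (s * ω ^ 2 * (Real.cos (ω * x) * (1 + s) - s) / (1 + s * (1 - Real.cos (ω * x))) ^ 2)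
    + (α * (s * ω * Real.sin (ω * x) / (1 + s * (1 - Real.cos (ω * x))))) ^ 2

theorem one_le_dip {s : ℝ} (hs : 0 ≤ s) (y : ℝ) : 1 ≤ 1 + s * (1 - Real.cos y) := by
  have := mul_nonneg hs (sub_nonneg.2 (Real.cos_le_one y))
  linarith

theorem hasDerivAt_log_dip {ω s : ℝ} (hs : 0 ≤ s) (x : ℝ) :
    HasDerivAt (fun x => Real.log (1 + s * (1 - Real.cos (ω * x))))
      (s * ω * Real.sin (ω * x) / (1 + s * (1 - Real.cos (ω * x)))) x := by
  have h1 : HasDerivAt (fun x : ℝ => ω * x) ω x := by simpa using (hasDerivAt_id x).const_mul ω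
  have h2 := ((h1.cos.const_sub 1).const_mul s).const_add 1
  convert! h2.log (zero_lt_one.trans_le (one_le_dip hs (ω * x))).ne' using 1
  ring

theorem hasDerivAt_deriv_log_dip {ω s : ℝ} (hs : 0 ≤ s) (x : ℝ) :
    HasDerivAt (fun x => s * ω * Real.sin (ω * x) / (1 + s * (1 - Real.cos (ω * x))))
      (s * ω ^ 2 * (Real.cos (ω * x) * (1 + s) - s) / (1 + s * (1 - Real.cos (ω * x))) ^ 2) x := by
  have h1 : HasDerivAt (fun x : ℝ => ω * x) ω x := by simpa using (hasDerivAt_id x).const_mul ω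
  have h2 := ((h1.cos.const_sub 1).const_mul s).const_add 1
  have h3 := (h1.sin.const_mul (s * ω)).div h2 (zero_lt_one.trans_le (one_le_dip hs (ω * x))).ne'
  convert! h3 using 1
  congr 1
  linear_combination (s ^ 2 * ω ^ 2) * Real.sin_sq_add_cos_sq (ω * x)

theorem isPrincipalEigenvalue_dipPotential {L : ℝ} (hL : 0 < L) {s : ℝ} (hs : 0 ≤ s) (α E : ℝ) :
    IsPrincipalEigenvalue L (fun x => E + dipPotential (2 * Real.pi / L) α s x) E := by
  have hωL : 2 * Real.pi / L * L = 2 * Real.pi := by field_simp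
  refine isPrincipalEigenvalue_of_log_groundState hL
    (fun x => (hasDerivAt_log_dip (ω := 2 * Real.pi / L) hs x).const_mul α)
    (fun x => (hasDerivAt_deriv_log_dip hs x).const_mul α) ?_ ?_ ?_ E
  · refine continuous_const.mul (Continuous.div (by fun_prop) (by fun_prop) fun x => ?_)
    have := one_le_dip hs (2 * Real.pi / L * x)
    positivity
  · simp [hωL]
  · simp [hωL]

theorem continuous_dipPotential {X : Type*} [TopologicalSpace X] (ω : ℝ) {α s x : X → ℝ}
    (hα : Continuous α) (hs : Continuous s) (hx : Continuous x) (hs0 : ∀ p, 0 ≤ s p) :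
    Continuous fun p => dipPotential ω (α p) (s p) (x p) := by
  have hne : ∀ p, 1 + s p * (1 - Real.cos (ω * x p)) ≠ 0 := fun p =>
    (zero_lt_one.trans_le (one_le_dip (hs0 p) _)).ne'
  unfold dipPotential
  exact (hα.mul (Continuous.div (by fun_prop) (by fun_prop) fun p => pow_ne_zero 2 (hne p))).add
    ((hα.mul (Continuous.div (by fun_prop) (by fun_prop) hne)).pow 2)

theorem mem_principalEigenvaluesWith_dipPotential {L m J μ α s x₀ : ℝ} (hL : 0 < L) (hs : 0 ≤ s)
    (hμ : ∀ x, 0 ≤ μ + dipPotential (2 * Real.pi / L) α s x) (hx₀ : x₀ ∈ Icc 0 L)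
    (hμx₀ : μ + dipPotential (2 * Real.pi / L) α s x₀ = 0)
    (hJ : 1 / L * ∫ x in (0 : ℝ)..L, Real.sqrt (μ + dipPotential (2 * Real.pi / L) α s x) = J) :
    m + μ ∈ principalEigenvaluesWith L m J := by
  have hc : Continuous fun x => m + μ + dipPotential (2 * Real.pi / L) α s x :=
    continuous_const.add
      (continuous_dipPotential _ continuous_const continuous_const continuous_id fun _ => hs)
  have hinf : potentialInf L (fun x => m + μ + dipPotential (2 * Real.pi / L) α s x) = m :=
    potentialInf_eq_of_isMin hL hc (fun x => by linarith [hμ x]) hx₀ (by linarith)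
  refine ⟨_, hc, fun x => ?_, hinf, ?_, isPrincipalEigenvalue_dipPotential hL hs α (m + μ)⟩
  · have : 2 * Real.pi / L * (x + L) = 2 * Real.pi / L * x + 2 * Real.pi := by field_simp
    simp only [dipPotential, this, Real.cos_add_two_pi, Real.sin_add_two_pi]
  · rw [meanSqrt, hinf, ← hJ]
    simp only [add_assoc, add_sub_cancel_left]

theorem exists_mean_eq {L J T : ℝ} (hL : 0 < L) {W : ℝ → ℝ → ℝ}
    (hW : Continuous (Function.uncurry W)) (hW0 : ∀ x, W 0 x = 0) (hJ : 0 ≤ J) (hT : 0 ≤ T)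
    (hWT : J * L ≤ ∫ x in (0 : ℝ)..L, W T x) :
    ∃ t, 0 ≤ t ∧ 1 / L * ∫ x in (0 : ℝ)..L, W t x = J := by
  have hc : Continuous fun t => 1 / L * ∫ x in (0 : ℝ)..L, W t x :=
    continuous_const.mul
      (intervalIntegral.continuous_parametric_intervalIntegral_of_continuous' hW 0 L)
  have hmem : J ∈ Icc (1 / L * ∫ x in (0 : ℝ)..L, W 0 x) (1 / L * ∫ x in (0 : ℝ)..L, W T x) := by
    refine ⟨by simpa [hW0] using hJ, ?_⟩
    rw [one_div, ← div_eq_inv_mul, le_div_iff₀ hL]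
    exact hWT
  obtain ⟨t, ht, hteq⟩ := intermediate_value_Icc hT hc.continuousOn hmem
  exact ⟨t, ht.1, hteq⟩

/-! ### Sharpness of the first bound -/

/-- Here `log f` has nonpositive second derivative, so `h = -a log f` has `h'' + h'² ≥ 0`. -/
theorem le_dipPotential_of_cos_le {ω a s x : ℝ} (ha : 0 ≤ a) (hs : 0 ≤ s)
    (hx : Real.cos (ω * x) * (1 + s) ≤ s) :
    a * s * ω ^ 2 ≤ a * s * ω ^ 2 + dipPotential ω (-a) s x := by
  have h1 : s * ω ^ 2 * (Real.cos (ω * x) * (1 + s) - s) / (1 + s * (1 - Real.cos (ω * x))) ^ 2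
      ≤ 0 := div_nonpos_of_nonpos_of_nonneg
    (mul_nonpos_of_nonneg_of_nonpos (by positivity) (by linarith)) (sq_nonneg _)
  rw [dipPotential]
  nlinarith [sq_nonneg (-a * (s * ω * Real.sin (ω * x) / (1 + s * (1 - Real.cos (ω * x)))))]

theorem dipPotential_nonneg_of_neg {ω a s : ℝ} (ha : 0 ≤ a) (hs : 0 ≤ s) (x : ℝ) :
    0 ≤ a * s * ω ^ 2 + dipPotential ω (-a) s x := by
  have hf := one_le_dip hs (ω * x)
  have h1 : s * ω ^ 2 * (Real.cos (ω * x) * (1 + s) - s) / (1 + s * (1 - Real.cos (ω * x))) ^ 2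
      ≤ s * ω ^ 2 := by
    rw [div_le_iff₀ (by positivity)]
    refine mul_le_mul_of_nonneg_left ?_ (by positivity)
    nlinarith [Real.cos_le_one (ω * x)]
  rw [dipPotential]
  nlinarith [sq_nonneg (-a * (s * ω * Real.sin (ω * x) / (1 + s * (1 - Real.cos (ω * x)))))]

theorem cos_le_cos_of_mem_Icc {δ y : ℝ} (hδ : 0 ≤ δ) (hy : y ∈ Icc δ (2 * Real.pi - δ)) :
    Real.cos y ≤ Real.cos δ := by
  rcases le_total y Real.pi with h | h
  · exact Real.cos_le_cos_of_nonneg_of_le_pi hδ h hy.1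
  · rw [← Real.cos_two_pi_sub y]
    exact Real.cos_le_cos_of_nonneg_of_le_pi hδ (by linarith) (by linarith [hy.2])

/-- Outside a `δ`-neighbourhood of the dip, `V - m` is at least `μ = E - m`, so `(L - 2δ) √μ ≤ J L`;
a small `δ` gives `√μ ≤ K`. The amplitude `a` is tuned by continuity to make `I = J`. -/
theorem exists_principalEigenvalue_le_sq {L m J K : ℝ} (hL : 0 < L) (hJ : 0 ≤ J) (hK : J < K) :
    ∃ E ∈ principalEigenvaluesWith L m J, E ≤ m + K ^ 2 := by
  have hK0 : 0 < K := hJ.trans_lt hK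
  set ω := 2 * Real.pi / L with hω
  have hω0 : 0 < ω := by positivity
  have hωL : ω * L = 2 * Real.pi := by rw [hω]; field_simp
  set δ := L * (K - J) / (4 * K) with hδ
  have hδ0 : 0 < δ := by have := sub_pos.2 hK; positivity
  have hLδ : L - 2 * δ = L * (K + J) / (2 * K) := by rw [hδ]; field_simp; ring
  have hLδ0 : 0 < L - 2 * δ := by rw [hLδ]; positivity
  have hcos : Real.cos (ω * δ) < 1 := by
    have h1 : ω * δ < 2 * Real.pi := by rw [← hωL]; exact mul_lt_mul_of_pos_left (by linarith) hω0
    refine lt_of_le_of_ne (Real.cos_le_one _) fun h => ?_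
    have := (Real.cos_eq_one_iff_of_lt_of_lt (by nlinarith [mul_pos hω0 hδ0, Real.pi_pos]) h1).1 h
    exact (mul_pos hω0 hδ0).ne' this
  -- Away from the dip this makes `s (1 - cos (ω x)) ≥ 1 ≥ cos (ω x)`.
  set s := 1 / (1 - Real.cos (ω * δ)) with hs
  have hs1 : s * (1 - Real.cos (ω * δ)) = 1 := by
    rw [hs]; exact one_div_mul_cancel (sub_pos.2 hcos).ne'
  have hs0 : 0 < s := one_div_pos.2 (sub_pos.2 hcos)
  have hoff : ∀ x ∈ Icc δ (L - δ), Real.cos (ω * x) * (1 + s) ≤ s := fun x hx => by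
    have h1 : Real.cos (ω * x) ≤ Real.cos (ω * δ) := by
      refine cos_le_cos_of_mem_Icc (by positivity) ⟨by gcongr; exact hx.1, ?_⟩
      rw [← hωL, ← mul_sub]
      gcongr
      exact hx.2
    nlinarith
  set W : ℝ → ℝ → ℝ := fun a x => Real.sqrt (a * s * ω ^ 2 + dipPotential ω (-a) s x) with hW
  have hWc : Continuous (Function.uncurry W) := by
    refine Real.continuous_sqrt.comp (Continuous.add (by fun_prop) ?_)
    exact continuous_dipPotential ω (by fun_prop) continuous_const continuous_snd fun _ => hs0.le
  have hWlow : ∀ a, 0 ≤ a →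
      (L - 2 * δ) * Real.sqrt (a * s * ω ^ 2) ≤ ∫ x in (0 : ℝ)..L, W a x := fun a ha => by
    have hWa : Continuous (W a) := hWc.comp (by fun_prop : Continuous fun x => (a, x))
    calc (L - 2 * δ) * Real.sqrt (a * s * ω ^ 2)
        = ∫ x in δ..(L - δ), Real.sqrt (a * s * ω ^ 2) := by
          rw [intervalIntegral.integral_const, smul_eq_mul]; ring
      _ ≤ ∫ x in δ..(L - δ), W a x := by
          refine intervalIntegral.integral_mono_on (by linarith) intervalIntegrable_const
            (hWa.intervalIntegrable _ _) fun x hx => ?_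
          exact Real.sqrt_le_sqrt (le_dipPotential_of_cos_le ha hs0.le (hoff x hx))
      _ ≤ ∫ x in (0 : ℝ)..L, W a x := by
          refine intervalIntegral.integral_mono_interval hδ0.le (by linarith) (by linarith)
            (Filter.Eventually.of_forall fun x => Real.sqrt_nonneg _) (hWa.intervalIntegrable _ _)
  -- The amplitude at which the lower bound `hWlow` equals `J L`.
  set T := (J * L / (L - 2 * δ)) ^ 2 / (s * ω ^ 2) with hT
  have hTs : Real.sqrt (T * s * ω ^ 2) = J * L / (L - 2 * δ) := by
    rw [mul_assoc, hT, div_mul_cancel₀ _ (by positivity), Real.sqrt_sq (by positivity)]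
  obtain ⟨a, ha, haJ⟩ := exists_mean_eq hL hWc (fun x => by simp [hW, dipPotential]) hJ
    (by positivity : 0 ≤ T) (by
      refine le_trans (le_of_eq ?_) (hWlow T (by positivity))
      rw [hTs]
      field_simp)
  refine ⟨m + a * s * ω ^ 2, mem_principalEigenvaluesWith_dipPotential hL hs0.le
    (dipPotential_nonneg_of_neg ha hs0.le) (left_mem_Icc.2 hL.le) ?_ haJ, ?_⟩
  · simp [dipPotential]
    ring
  · have h1 := hWlow a ha
    rw [one_div, ← div_eq_inv_mul, div_eq_iff hL.ne'] at haJ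
    rw [haJ, hLδ] at h1
    have h2 : Real.sqrt (a * s * ω ^ 2) ≤ K := by
      by_contra! hlt
      have h3 : L * (K + J) / (2 * K) * K < L * (K + J) / (2 * K) * Real.sqrt (a * s * ω ^ 2) :=
        mul_lt_mul_of_pos_left hlt (by positivity)
      have h4 : L * (K + J) / (2 * K) * K = L * (K + J) / 2 := by field_simp
      nlinarith
    have h5 := (Real.sqrt_le_left hK0.le).1 h2
    linarith

/-! ### Sharpness of the second bound -/

/-- Splitting `α² = α (2α - 1)/2 + α/2` leaves a remainder with the factor `1 + cos (ω x)`: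
nonnegative for `α ≥ 0`, and zero at the half period, where the potential has its minimum once `α >
1/2`. -/
theorem dipPotential_eq {ω α s : ℝ} (hs : 0 ≤ s) (x : ℝ) :
    α * s * ω ^ 2 / (1 + 2 * s) + dipPotential ω α s x
      = α * (2 * α - 1) / 2
          * (s * ω * Real.sin (ω * x) / (1 + s * (1 - Real.cos (ω * x)))) ^ 2
        + α * s * ω ^ 2 / ((1 + s * (1 - Real.cos (ω * x))) ^ 2 * (1 + 2 * s))
          * ((1 + Real.cos (ω * x)) * ((1 - Real.cos (ω * x)) / 2 * (1 + 2 * s)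
            + (1 + Real.cos (ω * x)) / 2 * (1 + s))) := by
  have hf := (zero_lt_one.trans_le (one_le_dip hs (ω * x))).ne'
  have h2 : 1 + 2 * s ≠ 0 := by positivity
  have hsc := Real.sin_sq_add_cos_sq (ω * x)
  rw [dipPotential]
  generalize Real.sin (ω * x) = S at *
  generalize Real.cos (ω * x) = C at *
  have key : α * s * ω ^ 2 / (1 + 2 * s) + (α * (s * ω ^ 2 * (C * (1 + s) - s)
        / (1 + s * (1 - C)) ^ 2) + (α * (s * ω * S / (1 + s * (1 - C)))) ^ 2)
      - (α * (2 * α - 1) / 2 * (s * ω * S / (1 + s * (1 - C))) ^ 2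
        + α * s * ω ^ 2 / ((1 + s * (1 - C)) ^ 2 * (1 + 2 * s))
          * ((1 + C) * ((1 - C) / 2 * (1 + 2 * s) + (1 + C) / 2 * (1 + s))))
      = α * s ^ 2 * ω ^ 2 / (2 * (1 + s * (1 - C)) ^ 2) * (S ^ 2 + C ^ 2 - 1) := by
    field_simp
    ring
  rw [hsc, sub_self, mul_zero] at key
  exact sub_eq_zero.1 key

theorem sq_deriv_log_le_dipPotential {ω α s : ℝ} (hα : 1 / 2 < α) (hs : 0 ≤ s) (x : ℝ) :
    α * (2 * α - 1) / 2 * (s * ω * Real.sin (ω * x) / (1 + s * (1 - Real.cos (ω * x)))) ^ 2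
      ≤ α * s * ω ^ 2 / (1 + 2 * s) + dipPotential ω α s x := by
  rw [dipPotential_eq hs]
  have h1 := sub_nonneg.2 (Real.cos_le_one (ω * x))
  have h2 : 0 ≤ 1 + Real.cos (ω * x) := by linarith [Real.neg_one_le_cos (ω * x)]
  have hf := one_le_dip hs (ω * x)
  refine le_add_of_nonneg_right ?_
  have : 0 < α := by linarith
  positivity

/-- For `α > 1/2`, `√(V - m)` dominates a positive multiple of `(log f)'`, whose integral up to the
half period is `log (1 + 2s)`. This is unbounded in `s` while `E - m` stays below `α ω²/2`, so every
`J` is reached. -/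
theorem exists_principalEigenvalue_le_of_half_lt {L m J α : ℝ} (hL : 0 < L) (hJ : 0 ≤ J)
    (hα : 1 / 2 < α) :
    ∃ E ∈ principalEigenvaluesWith L m J, E ≤ m + α * (2 * Real.pi / L) ^ 2 / 2 := by
  have hα0 : 0 < α := by linarith
  set ω := 2 * Real.pi / L with hω
  have hω0 : 0 < ω := by positivity
  have hωL : ω * (L / 2) = Real.pi := by rw [hω]; field_simp
  set K := Real.sqrt (α * (2 * α - 1) / 2) with hK
  have hc0 : 0 < α * (2 * α - 1) / 2 := by
    have : 0 < 2 * α - 1 := by linarith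
    positivity
  have hK0 : 0 < K := Real.sqrt_pos.2 hc0
  have hK2 : K ^ 2 = α * (2 * α - 1) / 2 := Real.sq_sqrt hc0.le
  -- `|s|` makes the family continuous for all real `s`.
  set W : ℝ → ℝ → ℝ := fun s x =>
    Real.sqrt (α * |s| * ω ^ 2 / (1 + 2 * |s|) + dipPotential ω α |s| x) with hW
  have hWc : Continuous (Function.uncurry W) := by
    refine Real.continuous_sqrt.comp (Continuous.add
      (Continuous.div (by fun_prop) (by fun_prop) fun p => by positivity) ?_)
    exact continuous_dipPotential ω continuous_const (by fun_prop) continuous_snd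
      fun _ => abs_nonneg _
  have hWlow : ∀ s, 0 ≤ s → K * Real.log (1 + 2 * s) ≤ ∫ x in (0 : ℝ)..L, W s x := fun s hs => by
    have hWs : Continuous (W s) := hWc.comp (by fun_prop : Continuous fun x => (s, x))
    have hgc : Continuous fun x => s * ω * Real.sin (ω * x) / (1 + s * (1 - Real.cos (ω * x))) :=
      Continuous.div (by fun_prop) (by fun_prop)
        fun x => (zero_lt_one.trans_le (one_le_dip hs (ω * x))).ne'
    -- Half a period only: over the full period `(log f)'` integrates to zero.
    calc K * Real.log (1 + 2 * s)
        = ∫ x in (0 : ℝ)..(L / 2),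
            K * (s * ω * Real.sin (ω * x) / (1 + s * (1 - Real.cos (ω * x)))) := by
          rw [intervalIntegral.integral_const_mul,
            intervalIntegral.integral_eq_sub_of_hasDerivAt (fun x _ => hasDerivAt_log_dip hs x)
              (hgc.intervalIntegrable _ _), hωL]
          simp only [Real.cos_pi, mul_zero, Real.cos_zero, sub_self, add_zero, Real.log_one,
            sub_zero]
          ring_nf
      _ ≤ ∫ x in (0 : ℝ)..(L / 2), W s x := by
          refine intervalIntegral.integral_mono_on (by positivity)
            ((hgc.const_mul K).intervalIntegrable _ _) (hWs.intervalIntegrable _ _) fun x _ => ?_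
          refine Real.le_sqrt_of_sq_le ?_
          rw [mul_pow, hK2, abs_of_nonneg hs]
          exact sq_deriv_log_le_dipPotential hα hs x
      _ ≤ ∫ x in (0 : ℝ)..L, W s x := by
          refine intervalIntegral.integral_mono_interval le_rfl (by positivity) (by linarith)
            (Filter.Eventually.of_forall fun x => Real.sqrt_nonneg _) (hWs.intervalIntegrable _ _)
  set T := (Real.exp (J * L / K) - 1) / 2 with hT
  have hT0 : 0 ≤ T := by
    have : 1 ≤ Real.exp (J * L / K) := Real.one_le_exp (by positivity)
    rw [hT]
    linarith
  have hTlog : Real.log (1 + 2 * T) = J * L / K := by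
    rw [hT, mul_div_cancel₀ _ two_ne_zero, add_sub_cancel, Real.log_exp]
  obtain ⟨s, hs, hsJ⟩ := exists_mean_eq hL hWc (fun x => by simp [hW, dipPotential]) hJ hT0 (by
      refine le_trans (le_of_eq ?_) (hWlow T hT0)
      rw [hTlog]
      field_simp)
  simp only [hW, abs_of_nonneg hs] at hsJ
  refine ⟨m + α * s * ω ^ 2 / (1 + 2 * s), mem_principalEigenvaluesWith_dipPotential
    (x₀ := L / 2) hL hs (fun x => ?_) ⟨by positivity, by linarith⟩ ?_ hsJ, ?_⟩
  · exact (mul_nonneg hc0.le (sq_nonneg _)).trans (sq_deriv_log_le_dipPotential hα hs x)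
  · rw [dipPotential_eq hs, hωL]
    simp
  · have : α * s * ω ^ 2 / (1 + 2 * s) ≤ α * ω ^ 2 / 2 := by
      rw [div_le_div_iff₀ (by positivity) two_pos]
      nlinarith [mul_pos hα0 (pow_pos hω0 2)]
    linarith

theorem corollary1 (L : ℝ) (hL : 0 < L) :
    -- the lower bounds and the case of equality
    (∀ V : ℝ → ℝ, IntervalIntegrable V MeasureTheory.volume 0 L →
      BddBelow (V '' Set.Ioo 0 L) →
      ∀ E₀ : ℝ, IsPrincipalEigenvalue L V E₀ →
        (meanSqrt L V ≤ Real.pi / L → potentialInf L V + meanSqrt L V ^ 2 ≤ E₀) ∧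
        (Real.pi / L < meanSqrt L V → potentialInf L V + Real.pi ^ 2 / L ^ 2 ≤ E₀) ∧
        (meanSqrt L V < Real.pi / L →
          (E₀ = potentialInf L V + meanSqrt L V ^ 2 ↔
            ∃ c : ℝ, ∀ᵐ x ∂MeasureTheory.volume.restrict (Set.Ioo 0 L), V x = c))) ∧
    -- sharpness of both bounds, already among continuous periodic potentials
    (∀ m J : ℝ, 0 ≤ J → J ≤ Real.pi / L →
      IsGLB (principalEigenvaluesWith L m J) (m + J ^ 2)) ∧
    (∀ m J : ℝ, Real.pi / L < J →
      IsGLB (principalEigenvaluesWith L m J) (m + Real.pi ^ 2 / L ^ 2)) := by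
  have hbdd : ∀ V : ℝ → ℝ, Continuous V → BddBelow (V '' Ioo 0 L) := fun V hV =>
    (isCompact_Icc.bddBelow_image (hV.continuousOn (s := Icc 0 L))).mono
      (image_mono Ioo_subset_Icc_self)
  refine ⟨fun V hV hb E₀ hE => ⟨eigenvalue_lower_bound_small hL hV hb hE.1,
    eigenvalue_lower_bound_large hL hV hb hE.1, fun hI => ⟨fun h =>
      ⟨E₀, potential_const_of_eigenvalue_eq hL hV hb hE.1 hI h⟩, fun ⟨c, hc⟩ =>
      principalEigenvalue_eq_of_potential_const hL hV hb hE hI hc⟩⟩, fun m J hJ hJL => ⟨?_, ?_⟩,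
    fun m J hJ => ⟨?_, ?_⟩⟩
  · rintro E ⟨V, hV, -, rfl, rfl, hE⟩
    exact eigenvalue_lower_bound_small hL (hV.intervalIntegrable _ _) (hbdd V hV) hE.1 hJL
  · intro b hb
    by_contra! hlt
    have h0 : 0 ≤ (b - m + J ^ 2) / 2 := by nlinarith
    have hJK : J < Real.sqrt ((b - m + J ^ 2) / 2) := Real.lt_sqrt_of_sq_lt (by linarith)
    obtain ⟨E, hE, hEle⟩ := exists_principalEigenvalue_le_sq (m := m) hL hJ hJK
    rw [Real.sq_sqrt h0] at hEle
    linarith [hb hE]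
  · rintro E ⟨V, hV, -, rfl, rfl, hE⟩
    exact eigenvalue_lower_bound_large hL (hV.intervalIntegrable _ _) (hbdd V hV) hE.1 hJ
  · intro b hb
    by_contra! hlt
    have hω : 0 < (2 * Real.pi / L) ^ 2 := by positivity
    have hπ : (2 * Real.pi / L) ^ 2 / 4 = Real.pi ^ 2 / L ^ 2 := by ring
    -- This `α` is the midpoint of `1/2` and `2 (b - m)/ω²`, with `ω = 2π/L`, so `α ω²/2 < b - m`.
    obtain ⟨E, hE, hEle⟩ := exists_principalEigenvalue_le_of_half_lt (m := m) (J := J)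
      (α := (b - m) / (2 * Real.pi / L) ^ 2 + 1 / 4) hL
      ((by positivity : 0 ≤ Real.pi / L).trans hJ.le) (by
        have : 1 / 4 < (b - m) / (2 * Real.pi / L) ^ 2 := by
          rw [lt_div_iff₀ hω]
          linarith
        linarith)
    rw [add_mul, div_mul_cancel₀ _ hω.ne'] at hEle
    linarith [hb hE]
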